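/- Let $n\ge 1$, let $\Omega\subset\mathbb R^n$ be a bounded open set, and let $u_1,u_2:\overline\Omega\to\mathbb R$ be continuous on $\overline\Omega$, locally Lipschitz in $\Omega$ and spacelike, i.e. $|Du_i|<1$ almost everywhere in $\Omega$ ($i=1,2$). Suppose that $u_1\ge u_2$ in $\overline\Omega$ and $u_1=u_2$ on $\partial\Omega$. Suppose further that $u_1$ is locally convex in $\Omega$ (that is, convex on a neighbourhood of each point of $\Omega$; in particular this holds if $u_1$ is convex), or that the graph of $u_1$ in Minkowski space $\mathbb R^{n,1}$ has nonnegative generalized mean curvature, that is, the vector field $\frac{Du_1}{\sqrt{1-|Du_1|^2}}$ is locally integrable in $\Omega$ and $$\operatorname{div}\Big(\frac{Du_1}{\sqrt{1-|Du_1|^2}}\Big)\ge 0 \quad\text{in } \Omega$$ in the sense of distributions: $$\int_\Omega \frac{Du_1\cdot D\varphi}{\sqrt{1-|Du_1|^2}}\,dx\le 0\qquad\text{for all } \varphi\in C_c^\infty(\Omega),\ \varphi\ge 0.$$ Then $$\int_\Omega\sqrt{1-|Du_1|^2}\,dx\ \ge\ \int_\Omega\sqrt{1-|Du_2|^2}\,dx,$$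 and equality holds if and only if $u_1=u_2$ in $\Omega$. -/

import Mathlib

open MeasureTheory
open scoped ContDiff

namespace MinkowskiGraph

noncomputable section

/-- The graph of `u` over `Ω ⊆ ℝⁿ` is spacelike in Minkowski space `ℝ^{n,1}`: `|Du| < 1` almost
everywhere in `Ω`. (For a locally Lipschitz `u` the gradient exists almost everywhere.) -/
def Spacelike {n : ℕ} (Ω : Set (EuclideanSpace ℝ (Fin n)))
    (u : EuclideanSpace ℝ (Fin n) → ℝ) : Prop :=
  ∀ᵐ x ∂(volume.restrict Ω), ‖gradient u x‖ < 1

/-- The Lorentzian area `∫_Ω √(1 - |Du|²) dx` of the graph of `u` over `Ω`. -/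
def area {n : ℕ} (Ω : Set (EuclideanSpace ℝ (Fin n)))
    (u : EuclideanSpace ℝ (Fin n) → ℝ) : ℝ :=
  ∫ x in Ω, Real.sqrt (1 - ‖gradient u x‖ ^ 2)

/-- `u` is locally convex in `Ω`: convex on a neighbourhood of each point of `Ω`. When `Ω` is
convex this is ordinary convexity on `Ω`. -/
def LocallyConvex {n : ℕ} (Ω : Set (EuclideanSpace ℝ (Fin n)))
    (u : EuclideanSpace ℝ (Fin n) → ℝ) : Prop :=
  ∀ x ∈ Ω, ∃ r : ℝ, 0 < r ∧ Metric.ball x r ⊆ Ω ∧ ConvexOn ℝ (Metric.ball x r) u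

/-- The vector field `Du / √(1 - |Du|²)`. -/
def meanCurvatureField {n : ℕ} (u : EuclideanSpace ℝ (Fin n) → ℝ)
    (x : EuclideanSpace ℝ (Fin n)) : EuclideanSpace ℝ (Fin n) :=
  (Real.sqrt (1 - ‖gradient u x‖ ^ 2))⁻¹ • gradient u x

/-- `div X ≥ 0` in `Ω` in the sense of distributions, for a locally integrable vector field `X`:
the distribution `φ ↦ -∫_Ω X · Dφ` is nonnegative on nonnegative test functions. -/
def DistribDivNonneg {n : ℕ} (Ω : Set (EuclideanSpace ℝ (Fin n)))
    (X : EuclideanSpace ℝ (Fin n) → EuclideanSpace ℝ (Fin n)) : Prop :=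
  LocallyIntegrableOn X Ω volume ∧
    ∀ φ : EuclideanSpace ℝ (Fin n) → ℝ, ContDiff ℝ ∞ φ → HasCompactSupport φ →
      tsupport φ ⊆ Ω → (∀ x, 0 ≤ φ x) →
        0 ≤ -∫ x in Ω, inner ℝ (X x) (gradient φ x)

/-- The graph of `u` over `Ω` has nonnegative generalized mean curvature:
`div (Du / √(1 - |Du|²)) ≥ 0` weakly in `Ω`. -/
def NonnegGeneralizedMeanCurvature {n : ℕ} (Ω : Set (EuclideanSpace ℝ (Fin n)))
    (u : EuclideanSpace ℝ (Fin n) → ℝ) : Prop :=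
  DistribDivNonneg Ω (meanCurvatureField u)

end

end MinkowskiGraph

/-!
Write `pᵢ = Duᵢ` and `w = u₁ - u₂ ≥ 0`. The result follows from the stability estimate
`½ ∫_Ω |p₁ - p₂|² ≤ area u₁ - area u₂` (`half_integral_norm_gradient_sub_sq_le`): it contains the
inequality of the areas, and when the areas agree it gives `Dw = 0` almost everywhere. Then every
truncation `(w - ε)⁺` with `ε > 0` is a compactly supported Lipschitz function with vanishing
gradient, so it is zero (`eq_zero_of_gradient_ae_eq_zero`), and `w = 0`.

For the estimate, `p ↦ -√(1 - |p|²)` is uniformly convex on the unit ball, with gradient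
`p / √(1 - |p|²)`. Hence, with `X = p₁ / √(1 - |p₁|²)`,
`½ |p₁ - p₂|² ≤ √(1 - |p₁|²) - √(1 - |p₂|²) + ⟨X, Dw⟩` pointwise (`half_norm_sub_sq_le`). Since `w`
need not have compact support in `Ω`, this is integrated over `{w > ε}`, where the last term is `X`
paired with the gradient of `(w - ε)⁺`. Because `div X ≥ 0`, that integral is nonpositive; passing
from smooth to Lipschitz test functions is a mollification argument
(`DistribDivNonneg.integral_inner_gradient_nonpos`). Finally `ε → 0`; on `{w = 0}` the gradients
coincide because `w` attains its minimum there.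

If `u₁` is locally convex, `X` may fail to be locally integrable: `|p₁|` can tend to `1` along a
null segment of the graph. The argument is therefore run with `c u₁`, `0 ≤ c < 1`, in place of `u₁`
in the definition of `X`; the error this causes in the pointwise estimate has a favourable sign, and
`c → 1` at the end. That the graph of `c u₁` has nonnegative generalized mean curvature
(`LocallyConvex.nonnegGeneralizedMeanCurvature`) is local. On a small ball the function extends to a
globally convex function with Lipschitz constant less than one; the mollifications of the extension
are smooth and convex, and for smooth convex `f`
`div (Df / √(1 - |Df|²)) = h Δf + h³ D²f(Df, Df) ≥ 0`, where `h = (1 - |Df|²)^(-1/2)`.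
-/

namespace MinkowskiGraph

open Filter Topology Set Metric

variable {n : ℕ}

local notation "E" => EuclideanSpace ℝ (Fin n)

/-! ### Mollification of Lipschitz functions -/

/-- A smooth bump supported in the closed ball of radius `2 / (k + 1)`; normalized to integral one,
these are the mollifying kernels. The ratio of the two radii does not depend on `k`, which makes the
mollifications of a locally integrable function converge almost everywhere. -/
noncomputable def bump (n k : ℕ) : ContDiffBump (0 : EuclideanSpace ℝ (Fin n)) where
  rIn := 1 / (k + 1 : ℝ)
  rOut := 2 / (k + 1 : ℝ)
  rIn_pos := by positivity
  rIn_lt_rOut := by gcongr; norm_num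

/-- The convolution of `f` with the normalized kernel `bump n k`. -/
noncomputable def mollify (k : ℕ) (f : E → ℝ) (x : E) : ℝ :=
  ∫ t, (bump n k).normed volume t * f (x - t)

lemma mollify_eq_convolution (k : ℕ) (f : E → ℝ) :
    mollify k f = convolution ((bump n k).normed volume) f (ContinuousLinearMap.lsmul ℝ ℝ)
      volume := by
  ext x
  simp [mollify, convolution]

lemma tendsto_bump_rOut : Tendsto (fun k => (bump n k).rOut) atTop (𝓝 0) :=
  by simpa [bump, div_eq_mul_inv] using
    (tendsto_one_div_add_atTop_nhds_zero_nat (𝕜 := ℝ)).const_mul 2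

lemma contDiff_mollify (k : ℕ) {f : E → ℝ} (hf : Continuous f) : ContDiff ℝ ∞ (mollify k f) := by
  rw [mollify_eq_convolution]
  exact (bump n k).hasCompactSupport_normed.contDiff_convolution_left _
    (bump n k).contDiff_normed hf.locallyIntegrable

lemma integrable_bump_mul (k : ℕ) {f : E → ℝ} (hf : Continuous f) (x : E) :
    Integrable fun t => (bump n k).normed volume t * f (x - t) := by
  apply Continuous.integrable_of_hasCompactSupport
  · exact (bump n k).continuous_normed.mul (by fun_prop)
  · exact (bump n k).hasCompactSupport_normed.mul_right

lemma norm_gradient (f : E → ℝ) (x : E) : ‖gradient f x‖ = ‖fderiv ℝ f x‖ := by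
  simp [gradient]

lemma norm_gradient_le {f : E → ℝ} {L : NNReal} (hf : LipschitzWith L f) (x : E) :
    ‖gradient f x‖ ≤ L := by
  rw [norm_gradient]
  exact norm_fderiv_le_of_lipschitz ℝ hf

@[fun_prop]
lemma measurable_gradient (f : E → ℝ) : Measurable (gradient f) :=
  (InnerProductSpace.toDual ℝ E).symm.continuous.measurable.comp (measurable_fderiv ℝ f)

lemma locallyIntegrable_gradient {f : E → ℝ} {L : NNReal} (hf : LipschitzWith L f) :
    LocallyIntegrable (gradient f) := by
  refine (locallyIntegrable_const (L : ℝ)).mono (measurable_gradient f).aestronglyMeasurable ?_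
  filter_upwards with x
  simpa using norm_gradient_le hf x

lemma integrable_bump_smul_gradient (k : ℕ) {f : E → ℝ} {L : NNReal} (hf : LipschitzWith L f)
    (x : E) : Integrable fun t => (bump n k).normed volume t • gradient f (x - t) := by
  refine (bump n k).integrable_normed.smul_bdd (L : ℝ)
    ((measurable_gradient f).comp (measurable_const.sub measurable_id)).aestronglyMeasurable ?_
  filter_upwards with t using norm_gradient_le hf _

/-- `D(ρ ⋆ f) = ρ ⋆ Df` for the almost everywhere defined gradient of a Lipschitz function `f`. -/
lemma hasGradientAt_mollify (k : ℕ) {f : E → ℝ} {L : NNReal} (hf : LipschitzWith L f) (x : E) :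
    HasGradientAt (mollify k f) (∫ t, (bump n k).normed volume t • gradient f (x - t)) x := by
  have hdiff : ∀ᵐ t : E, DifferentiableAt ℝ f (x - t) :=
    (Measure.measurePreserving_sub_left volume x).quasiMeasurePreserving.ae
      hf.ae_differentiableAt
  have key := hasFDerivAt_integral_of_dominated_loc_of_lip (μ := volume) (𝕜 := ℝ) (x₀ := x)
    (s := univ) (F := fun y t => (bump n k).normed volume t * f (y - t))
    (bound := fun t => (bump n k).normed volume t * L)
    (F' := fun t => (bump n k).normed volume t • fderiv ℝ f (x - t)) univ_mem
    (Eventually.of_forall fun y => (integrable_bump_mul k hf.continuous y).aestronglyMeasurable)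
    (integrable_bump_mul k hf.continuous x) ?_ ?_
    ((bump n k).integrable_normed.mul_const _) ?_
  · obtain ⟨hi, key⟩ := key
    rw [hasGradientAt_iff_hasFDerivAt]
    refine key.congr_fderiv (ContinuousLinearMap.ext fun e => ?_)
    rw [InnerProductSpace.toDual_apply_apply, real_inner_comm,
      ← integral_inner (integrable_bump_smul_gradient k hf x), ContinuousLinearMap.integral_apply hi]
    simp [inner_smul_right, inner_gradient_right]
  · refine AEStronglyMeasurable.smul (bump n k).continuous_normed.aestronglyMeasurable ?_
    exact ((measurable_fderiv ℝ f).comp (by fun_prop)).aestronglyMeasurable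
  · filter_upwards with t
    refine LipschitzOnWith.of_dist_le_mul fun y _ z _ => ?_
    have h0 := (bump n k).nonneg_normed (μ := volume) t
    have := hf.dist_le_mul (y - t) (z - t)
    rw [Real.dist_eq] at this ⊢
    rw [← mul_sub, abs_mul, abs_of_nonneg h0, Real.coe_nnabs,
      abs_mul _ (L : ℝ), abs_of_nonneg h0, NNReal.abs_eq, mul_assoc]
    simpa using mul_le_mul_of_nonneg_left this h0
  · filter_upwards [hdiff] with t ht
    have h1 : HasFDerivAt (fun y => f (y - t)) (fderiv ℝ f (x - t)) x := by
      exact ht.hasFDerivAt.comp x ((hasFDerivAt_id x).sub_const t)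
    simpa using h1.const_mul ((bump n k).normed volume t)

lemma gradient_mollify (k : ℕ) {f : E → ℝ} {L : NNReal} (hf : LipschitzWith L f) (x : E) :
    gradient (mollify k f) x = ∫ t, (bump n k).normed volume t • gradient f (x - t) :=
  (hasGradientAt_mollify k hf x).gradient

lemma norm_gradient_mollify_le (k : ℕ) {f : E → ℝ} {L : NNReal} (hf : LipschitzWith L f) (x : E) :
    ‖gradient (mollify k f) x‖ ≤ L := by
  rw [gradient_mollify k hf]
  calc _ ≤ ∫ t, (bump n k).normed volume t * (L : ℝ) := by
        refine norm_integral_le_of_norm_le ((bump n k).integrable_normed.mul_const _) ?_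
        filter_upwards with t
        rw [norm_smul, Real.norm_of_nonneg ((bump n k).nonneg_normed t)]
        exact mul_le_mul_of_nonneg_left (norm_gradient_le hf _) ((bump n k).nonneg_normed t)
    _ = L := by rw [integral_mul_const, (bump n k).integral_normed, one_mul]

lemma ae_tendsto_gradient_mollify {f : E → ℝ} {L : NNReal} (hf : LipschitzWith L f) :
    ∀ᵐ x, Tendsto (fun k => gradient (mollify k f) x) atTop (𝓝 (gradient f x)) := by
  have h := ContDiffBump.ae_convolution_tendsto_right_of_locallyIntegrable (φ := bump n) (K := 2)
    tendsto_bump_rOut (Eventually.of_forall fun k => le_of_eq (by simp [bump]; ring))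
    (locallyIntegrable_gradient hf)
  filter_upwards [h] with x hx
  refine hx.congr fun k => ?_
  rw [gradient_mollify k hf]
  rfl

lemma tendsto_mollify {f : E → ℝ} (hf : Continuous f) (x : E) :
    Tendsto (fun k => mollify k f x) atTop (𝓝 (f x)) := by
  simp_rw [mollify_eq_convolution]
  exact ContDiffBump.convolution_tendsto_right_of_continuous tendsto_bump_rOut hf x

lemma mollify_nonneg (k : ℕ) {f : E → ℝ} (hf : ∀ x, 0 ≤ f x) (x : E) : 0 ≤ mollify k f x :=
  integral_nonneg fun t => mul_nonneg ((bump n k).nonneg_normed t) (hf _)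

lemma convexOn_mollify (k : ℕ) {f : E → ℝ} (hc : Continuous f) (hf : ConvexOn ℝ univ f) :
    ConvexOn ℝ univ (mollify k f) := by
  refine ⟨convex_univ, fun x _ y _ a b ha hb hab => ?_⟩
  simp only [mollify, smul_eq_mul]
  rw [← integral_const_mul, ← integral_const_mul, ← integral_add
    ((integrable_bump_mul k hc x).const_mul _) ((integrable_bump_mul k hc y).const_mul _)]
  refine integral_mono (integrable_bump_mul k hc _) (((integrable_bump_mul k hc x).const_mul _).add
    ((integrable_bump_mul k hc y).const_mul _)) fun t => ?_
  have h := hf.2 (mem_univ (x - t)) (mem_univ (y - t)) ha hb hab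
  have e : a • (x - t) + b • (y - t) = a • x + b • y - t := by
    rw [smul_sub, smul_sub, sub_add_sub_comm, ← add_smul, hab, one_smul]
  rw [e] at h
  have := mul_le_mul_of_nonneg_left h ((bump n k).nonneg_normed (μ := volume) t)
  simp only [smul_eq_mul] at this
  calc _ ≤ _ := this
    _ = _ := by ring

lemma tsupport_mollify_subset (k : ℕ) (f : E → ℝ) :
    tsupport (mollify k f) ⊆ cthickening (2 / (k + 1)) (tsupport f) := by
  refine closure_minimal (fun x hx => ?_) isClosed_cthickening
  rw [mollify_eq_convolution] at hx
  obtain ⟨t, ht, y, hy, rfl⟩ := support_convolution_subset _ hx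
  rw [(bump n k).support_normed_eq, mem_ball_zero_iff] at ht
  refine mem_cthickening_of_dist_le _ y _ _ (subset_tsupport f hy) ?_
  simpa [bump] using ht.le

/-- A compactly supported Lipschitz function whose gradient vanishes almost everywhere is zero:
its mollifications have zero gradient, hence are constant. -/
lemma eq_zero_of_gradient_ae_eq_zero (hn : 1 ≤ n) {f : E → ℝ} {L : NNReal}
    (hf : LipschitzWith L f) (hs : HasCompactSupport f) (h0 : ∀ᵐ x, gradient f x = 0) (x : E) :
    f x = 0 := by
  have hconst : ∀ y, f x = f y := fun y => by
    refine tendsto_nhds_unique (tendsto_mollify hf.continuous x)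
      ((tendsto_mollify hf.continuous y).congr fun k => ?_)
    refine is_const_of_fderiv_eq_zero (𝕜 := ℝ)
      ((contDiff_mollify k hf.continuous).differentiable (by simp)) (fun z => ?_) y x
    rw [← norm_eq_zero, ← norm_gradient, norm_eq_zero, gradient_mollify k hf]
    refine integral_eq_zero_of_ae ?_
    filter_upwards [(Measure.measurePreserving_sub_left volume z).quasiMeasurePreserving.ae h0]
      with t ht
    simp [ht]
  have : Nonempty (Fin n) := ⟨⟨0, hn⟩⟩
  obtain ⟨y, hy⟩ : ∃ y, y ∉ tsupport f := by
    by_contra! h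
    exact noncompact_univ E (by simpa [eq_univ_of_forall h] using hs.isCompact)
  rw [hconst y, image_eq_zero_of_notMem_tsupport hy]

/-! ### Smooth convex functions have nonnegative mean curvature -/

lemma add_inner_gradient_le {s : Set E} {f : E → ℝ} (hf : ConvexOn ℝ s f) {x y : E}
    (hx : x ∈ s) (hy : y ∈ s) (hd : DifferentiableAt ℝ f x) :
    f x + inner ℝ (gradient f x) (y - x) ≤ f y := by
  have hc := hf.comp_affineMap (AffineMap.lineMap x y : ℝ →ᵃ[ℝ] E)
  have hl : HasDerivAt (f ∘ (AffineMap.lineMap x y : ℝ →ᵃ[ℝ] E)) (fderiv ℝ f x (y - x)) 0 := by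
    refine HasFDerivAt.comp_hasDerivAt (0 : ℝ) ?_ AffineMap.hasDerivAt_lineMap
    simpa using hd.hasFDerivAt
  have h := hc.le_slope_of_hasDerivAt (x := 0) (y := 1) (by simpa using hx) (by simpa using hy)
    one_pos hl
  rw [slope_def_field] at h
  rw [inner_gradient_left]
  simp at h
  rw [map_sub]
  linarith

/-- The Hessian of a convex function is nonnegative. -/
lemma inner_fderiv_gradient_nonneg {f : E → ℝ} (hf : ConvexOn ℝ univ f)
    (hd : Differentiable ℝ f) (x : E) (hg : DifferentiableAt ℝ (gradient f) x) (e : E) :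
    0 ≤ inner ℝ (fderiv ℝ (gradient f) x e) e := by
  have hmono : Monotone fun t : ℝ => inner ℝ (gradient f (x + t • e)) e := by
    intro s t hst
    rcases hst.eq_or_lt with rfl | hlt
    · rfl
    have h1 := add_inner_gradient_le hf (mem_univ (x + s • e)) (mem_univ (x + t • e)) (hd _)
    have h2 := add_inner_gradient_le hf (mem_univ (x + t • e)) (mem_univ (x + s • e)) (hd _)
    rw [add_sub_add_left_eq_sub, ← sub_smul, inner_smul_right] at h1 h2
    have h3 : 0 < t - s := sub_pos.2 hlt
    simp only
    nlinarith
  have hder : HasDerivAt (fun t : ℝ => inner ℝ (gradient f (x + t • e)) e)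
      (inner ℝ (fderiv ℝ (gradient f) x e) e) 0 := by
    have h1 : HasDerivAt (fun t : ℝ => x + t • e) e 0 := by
      simpa using ((hasDerivAt_id (0 : ℝ)).smul_const e).const_add x
    have h2 : HasFDerivAt (gradient f) (fderiv ℝ (gradient f) x) (x + (0 : ℝ) • e) := by
      simpa using hg.hasFDerivAt
    simpa using (h2.comp_hasDerivAt (0 : ℝ) h1).inner ℝ (hasDerivAt_const (0 : ℝ) e)
  refine ge_of_tendsto (hasDerivAt_iff_tendsto_slope.1 hder) ?_
  filter_upwards [self_mem_nhdsWithin] with t ht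
  rw [slope_def_field, sub_zero]
  rcases lt_or_gt_of_ne (show t ≠ 0 from ht) with h | h
  · exact div_nonneg_of_nonpos (sub_nonpos.2 (hmono h.le)) h.le
  · exact div_nonneg (sub_nonneg.2 (hmono h.le)) h.le

lemma contDiff_gradient {f : E → ℝ} (hf : ContDiff ℝ ∞ f) : ContDiff ℝ ∞ (gradient f) :=
  (InnerProductSpace.toDual ℝ E).symm.contDiff.comp (hf.fderiv_right (by simp))

lemma one_sub_norm_sq_pos {p : E} (hp : ‖p‖ < 1) : 0 < 1 - ‖p‖ ^ 2 := by
  nlinarith [norm_nonneg p]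

lemma contDiff_meanCurvatureField {f : E → ℝ} (hf : ContDiff ℝ ∞ f)
    (hs : ∀ x, ‖gradient f x‖ < 1) : ContDiff ℝ ∞ (meanCurvatureField f) := by
  have hg := contDiff_gradient hf
  refine ContDiff.smul (ContDiff.inv (ContDiff.sqrt (contDiff_const.sub (hg.norm_sq ℝ)) ?_) ?_) hg
  · exact fun x => (one_sub_norm_sq_pos (hs x)).ne'
  · exact fun x => (Real.sqrt_pos.2 (one_sub_norm_sq_pos (hs x))).ne'

/-- With `h = (1 - |Df|²)^(-1/2)`, this is the identity
`∂_e (h ∂_e f) = h ∂_e∂_e f + h³ ⟨Df, ∂_e Df⟩ ∂_e f`. -/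
lemma fderiv_inner_meanCurvatureField {f : E → ℝ} (hf : ContDiff ℝ ∞ f) {x : E}
    (hs : ‖gradient f x‖ < 1) (e : E) :
    fderiv ℝ (fun y => inner ℝ (meanCurvatureField f y) e) x e =
      (Real.sqrt (1 - ‖gradient f x‖ ^ 2))⁻¹ * inner ℝ (fderiv ℝ (gradient f) x e) e +
      (Real.sqrt (1 - ‖gradient f x‖ ^ 2))⁻¹ ^ 3 *
        (inner ℝ (gradient f x) (fderiv ℝ (gradient f) x e) * inner ℝ (gradient f x) e) := by
  have hpos := one_sub_norm_sq_pos hs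
  have hg : HasFDerivAt (gradient f) (fderiv ℝ (gradient f) x) x :=
    ((contDiff_gradient hf).differentiable (by simp) x).hasFDerivAt
  have h1 := (hg.norm_sq.const_sub 1).sqrt hpos.ne'
  have h2 := (HasDerivAt.comp_hasFDerivAt x (hasDerivAt_inv (Real.sqrt_pos.2 hpos).ne') h1).mul
    (hg.inner ℝ (hasFDerivAt_const e x))
  have h3 : (fun y => inner ℝ (meanCurvatureField f y) e) =
      fun y => (Real.sqrt (1 - ‖gradient f y‖ ^ 2))⁻¹ * inner ℝ (gradient f y) e := by
    ext y
    rw [meanCurvatureField, real_inner_smul_left]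
  rw [h3]
  erw [h2.fderiv]
  have hne := (Real.sqrt_pos.2 hpos).ne'
  simp
  field_simp

lemma integrable_mul_of_hasCompactSupport {f g : E → ℝ} (hf : Continuous f) (hg : Continuous g)
    (hs : HasCompactSupport g) : Integrable fun x => f x * g x :=
  (hf.mul hg).integrable_of_hasCompactSupport hs.mul_left

lemma hasCompactSupport_gradient {f : E → ℝ} (hs : HasCompactSupport f) :
    HasCompactSupport (gradient f) :=
  (hs.fderiv ℝ).comp_left (g := (InnerProductSpace.toDual ℝ E).symm) (map_zero _)

/-- Integration by parts, with `div (Df / √(1 - |Df|²)) = h Δf + h³ D²f(Df, Df) ≥ 0` for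
`h = (1 - |Df|²)^(-1/2)`. -/
lemma integral_inner_meanCurvatureField_nonpos_of_contDiff {f : E → ℝ} (hf : ContDiff ℝ ∞ f)
    (hc : ConvexOn ℝ univ f) (hs : ∀ x, ‖gradient f x‖ < 1) {φ : E → ℝ} (hφ : ContDiff ℝ ∞ φ)
    (hφs : HasCompactSupport φ) (hφ0 : ∀ x, 0 ≤ φ x) :
    ∫ x, inner ℝ (meanCurvatureField f x) (gradient φ x) ≤ 0 := by
  set b := EuclideanSpace.basisFun (Fin n) ℝ with hb
  have hX := contDiff_meanCurvatureField hf hs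
  have hXi : ∀ i, ContDiff ℝ ∞ fun y => inner ℝ (meanCurvatureField f y) (b i) :=
    fun i => hX.inner ℝ contDiff_const
  have hd : ∀ (g : E → ℝ) (e : E), ContDiff ℝ ∞ g → Continuous fun x => fderiv ℝ g x e :=
    fun g e hg => (hg.continuous_fderiv (by simp)).clm_apply continuous_const
  have hfg' : ∀ i, Integrable fun x =>
      inner ℝ (meanCurvatureField f x) (b i) * fderiv ℝ φ x (b i) := fun i =>
    integrable_mul_of_hasCompactSupport (hXi i).continuous (hd _ _ hφ) (hφs.fderiv_apply ℝ (b i))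
  have hf'g : ∀ i, Integrable fun x =>
      fderiv ℝ (fun y => inner ℝ (meanCurvatureField f y) (b i)) x (b i) * φ x := fun i =>
    integrable_mul_of_hasCompactSupport (hd _ _ (hXi i)) hφ.continuous hφs
  have hsum : ∀ x, inner ℝ (meanCurvatureField f x) (gradient φ x) =
      ∑ i, inner ℝ (meanCurvatureField f x) (b i) * fderiv ℝ φ x (b i) := fun x => by
    rw [← b.sum_inner_mul_inner]
    simp [inner_gradient_right]
  simp_rw [hsum]
  rw [integral_finsetSum _ fun i _ => hfg' i]
  have hparts : ∀ i, ∫ x, inner ℝ (meanCurvatureField f x) (b i) * fderiv ℝ φ x (b i) =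
      -∫ x, fderiv ℝ (fun y => inner ℝ (meanCurvatureField f y) (b i)) x (b i) * φ x := fun i =>
    integral_mul_fderiv_eq_neg_fderiv_mul_of_integrable (hf'g i) (hfg' i)
      (integrable_mul_of_hasCompactSupport (hXi i).continuous hφ.continuous hφs)
      (fun x _ => (hXi i).differentiable (by simp) x) (fun x _ => hφ.differentiable (by simp) x)
  simp_rw [hparts]
  rw [Finset.sum_neg_distrib, ← integral_finsetSum _ fun i _ => hf'g i, neg_nonpos]
  refine integral_nonneg fun x => ?_
  simp only [Pi.zero_apply]
  rw [← Finset.sum_mul]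
  refine mul_nonneg ?_ (hφ0 x)
  simp_rw [fderiv_inner_meanCurvatureField hf (hs x)]
  rw [Finset.sum_add_distrib, ← Finset.mul_sum, ← Finset.mul_sum]
  have hH := inner_fderiv_gradient_nonneg hc (hf.differentiable (by simp)) x
    ((contDiff_gradient hf).differentiable (by simp) x)
  -- The second sum is the second derivative of `f` in the direction of its own gradient.
  have htr : ∑ i, inner ℝ (gradient f x) (fderiv ℝ (gradient f) x (b i)) *
      inner ℝ (gradient f x) (b i) =
      inner ℝ (fderiv ℝ (gradient f) x (gradient f x)) (gradient f x) := by
    have h := congrArg (fun v => inner ℝ (fderiv ℝ (gradient f) x v) (gradient f x))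
      (b.sum_repr' (gradient f x))
    simp only [map_sum, sum_inner, map_smul, real_inner_smul_left] at h
    rw [← h]
    refine Finset.sum_congr rfl fun i _ => ?_
    rw [real_inner_comm, real_inner_comm (b i), mul_comm]
  have hh : 0 ≤ (Real.sqrt (1 - ‖gradient f x‖ ^ 2))⁻¹ := by positivity
  rw [htr]
  exact add_nonneg (mul_nonneg hh (Finset.sum_nonneg fun i _ => hH _))
    (mul_nonneg (pow_nonneg hh 3) (hH _))

/-! ### Locally convex graphs have nonnegative generalized mean curvature -/

@[fun_prop]
lemma measurable_meanCurvatureField (f : E → ℝ) : Measurable (meanCurvatureField f) := by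
  unfold meanCurvatureField
  fun_prop

lemma norm_meanCurvatureField_le {f : E → ℝ} {L : ℝ} (hL : L < 1) {x : E}
    (hx : ‖gradient f x‖ ≤ L) :
    ‖meanCurvatureField f x‖ ≤ (Real.sqrt (1 - L ^ 2))⁻¹ * L := by
  have h0 := norm_nonneg (gradient f x)
  have hpos : 0 < 1 - L ^ 2 := by nlinarith
  rw [meanCurvatureField, norm_smul, Real.norm_of_nonneg (by positivity)]
  gcongr

lemma tendsto_meanCurvatureField {f : ℕ → E → ℝ} {g : E → ℝ} {x : E}
    (hx : ‖gradient g x‖ < 1)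
    (h : Tendsto (fun k => gradient (f k) x) atTop (𝓝 (gradient g x))) :
    Tendsto (fun k => meanCurvatureField (f k) x) atTop (𝓝 (meanCurvatureField g x)) := by
  have hne := (Real.sqrt_pos.2 (one_sub_norm_sq_pos hx)).ne'
  have hs : Tendsto (fun k => Real.sqrt (1 - ‖gradient (f k) x‖ ^ 2)) atTop
      (𝓝 (Real.sqrt (1 - ‖gradient g x‖ ^ 2))) :=
    (Real.continuous_sqrt.tendsto _).comp ((h.norm.pow 2).const_sub 1)
  exact (hs.inv₀ hne).smul h

/-- The limit of the smooth case along mollifications. The bound `L < 1` keeps the mean curvature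
fields uniformly bounded. -/
lemma integral_inner_meanCurvatureField_nonpos_of_convexOn {f : E → ℝ} {L : NNReal} (hL : L < 1)
    (hf : LipschitzWith L f) (hc : ConvexOn ℝ univ f) {φ : E → ℝ} (hφ : ContDiff ℝ ∞ φ)
    (hφs : HasCompactSupport φ) (hφ0 : ∀ x, 0 ≤ φ x) :
    ∫ x, inner ℝ (meanCurvatureField f x) (gradient φ x) ≤ 0 := by
  have hφg := contDiff_gradient hφ
  refine le_of_tendsto' (tendsto_integral_of_dominated_convergence
    (F := fun k x => inner ℝ (meanCurvatureField (mollify k f) x) (gradient φ x))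
    (fun x => (Real.sqrt (1 - (L : ℝ) ^ 2))⁻¹ * L * ‖gradient φ x‖) (fun k => ?_) ?_
    (fun k => ?_) ?_) fun k => ?_
  · exact ((measurable_meanCurvatureField _).inner (measurable_gradient _)).aestronglyMeasurable
  · exact integrable_mul_of_hasCompactSupport continuous_const hφg.continuous.norm
      (hasCompactSupport_gradient hφs).norm
  · filter_upwards with x
    refine (norm_inner_le_norm _ _).trans ?_
    gcongr
    exact norm_meanCurvatureField_le hL (norm_gradient_mollify_le k hf x)
  · filter_upwards [ae_tendsto_gradient_mollify hf] with x hx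
    exact (tendsto_meanCurvatureField
      ((norm_gradient_le hf x).trans_lt (by exact_mod_cast hL)) hx).inner tendsto_const_nhds
  · exact integral_inner_meanCurvatureField_nonpos_of_contDiff
      (contDiff_mollify k hf.continuous) (convexOn_mollify k hf.continuous hc)
      (fun x => (norm_gradient_mollify_le k hf x).trans_lt (by exact_mod_cast hL)) hφ hφs hφ0

/-- A convex function on a ball with `|Df| ≤ L` almost everywhere extends to a convex `L`-Lipschitz
function on the whole space: the supremum of its supporting affine functions at the points where
the gradient bound holds. -/
lemma exists_convexOn_lipschitzWith_eqOn {f : E → ℝ} {c : E} {r : ℝ} (hr : 0 < r) {L : NNReal}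
    (hf : ConvexOn ℝ (ball c r) f) (hcont : ContinuousOn f (ball c r))
    (hg : ∀ᵐ x, x ∈ ball c r → DifferentiableAt ℝ f x ∧ ‖gradient f x‖ ≤ L) :
    ∃ g : E → ℝ, LipschitzWith L g ∧ ConvexOn ℝ univ g ∧ EqOn f g (ball c r) := by
  set G : Set E := ball c r ∩
    {x | x ∈ ball c r → DifferentiableAt ℝ f x ∧ ‖gradient f x‖ ≤ L} with hG
  have hcl : ball c r ⊆ closure G :=
    (Measure.dense_of_ae hg).open_subset_closure_inter isOpen_ball
  have hcb : c ∈ ball c r := mem_ball_self hr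
  have : Nonempty G := (closure_nonempty_iff.1 ⟨c, hcl hcb⟩).to_subtype
  have hGL : ∀ (i : G) (v : E), inner ℝ (gradient f i) v ≤ L * ‖v‖ := fun i v =>
    (real_inner_le_norm _ _).trans (by gcongr; exact (i.2.2 i.2.1).2)
  have hsupp : ∀ (i : G), ∀ y ∈ ball c r, f i + inner ℝ (gradient f i) (y - i) ≤ f y :=
    fun i y hy => add_inner_gradient_le hf i.2.1 hy (i.2.2 i.2.1).1
  set a : G → E → ℝ := fun i y => f i + inner ℝ (gradient f i) (y - i) with ha
  have hbdd : ∀ y, BddAbove (range fun i => a i y) := fun y => by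
    refine ⟨f c + L * ‖y - c‖, ?_⟩
    rintro _ ⟨i, rfl⟩
    have h1 := hsupp i c hcb
    have h2 := hGL i (y - c)
    have h3 : inner ℝ (gradient f i) (y - i) = inner ℝ (gradient f i) (c - i) +
      inner ℝ (gradient f i) (y - c) := by rw [← inner_add_right]; congr 1; abel
    simp only [ha, h3]
    linarith
  have hlip : LipschitzWith L fun y => ⨆ i, a i y := by
    refine LipschitzWith.of_le_add_mul L fun x y => ciSup_le fun i => ?_
    have h1 := le_ciSup (hbdd y) i
    have h2 := hGL i (x - y)
    have h3 : inner ℝ (gradient f i) (x - i) = inner ℝ (gradient f i) (y - i) +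
      inner ℝ (gradient f i) (x - y) := by rw [← inner_add_right]; congr 1; abel
    rw [dist_eq_norm]
    simp only [ha, h3] at h1 ⊢
    linarith
  refine ⟨fun y => ⨆ i, a i y, hlip, ⟨convex_univ, fun x _ y _ s t hs ht hst => ?_⟩, ?_⟩
  · refine ciSup_le fun i => ?_
    have h1 := mul_le_mul_of_nonneg_left (le_ciSup (hbdd x) i) hs
    have h2 := mul_le_mul_of_nonneg_left (le_ciSup (hbdd y) i) ht
    have h3 : a i (s • x + t • y) = s * a i x + t * a i y := by
      have ht' : t = 1 - s := by linarith
      subst ht'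
      simp only [ha, inner_sub_right, inner_add_right, inner_smul_right]
      ring
    rw [h3]
    exact add_le_add h1 h2
  · refine EqOn.of_subset_closure (s := G) (fun y hy => ?_) hcont hlip.continuous.continuousOn
      inter_subset_left hcl
    refine le_antisymm ?_ (ciSup_le fun i => hsupp i y hy.1)
    have h := le_ciSup (hbdd y) ⟨y, hy⟩
    simpa [ha] using h

lemma gradient_eq_of_eqOn {f g : E → ℝ} {U : Set E} (hU : IsOpen U) (h : EqOn f g U) {x : E}
    (hx : x ∈ U) : gradient f x = gradient g x :=
  (h.eventuallyEq_of_mem (hU.mem_nhds hx)).gradient_eq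

lemma gradient_eq_zero_of_notMem_tsupport {f : E → ℝ} {x : E} (hx : x ∉ tsupport f) :
    gradient f x = 0 := by
  rw [← norm_eq_zero, norm_gradient, norm_eq_zero]
  exact image_eq_zero_of_notMem_tsupport fun h => hx (tsupport_fderiv_subset ℝ h)

lemma integrableOn_inner_of_locallyIntegrableOn {Ω K : Set E} {X Y : E → E}
    (hX : LocallyIntegrableOn X Ω) (hΩ : MeasurableSet Ω) (hK : IsCompact K) (hKΩ : K ⊆ Ω)
    (hY : Measurable Y) {C : ℝ} (hC : ∀ x, ‖Y x‖ ≤ C) (h0 : ∀ x ∉ K, Y x = 0) :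
    IntegrableOn (fun x => inner ℝ (X x) (Y x)) Ω := by
  have hXK := hX.integrableOn_compact_subset hKΩ hK
  refine IntegrableOn.of_forall_sdiff_eq_zero (s := K) ?_ hΩ fun x hx => by simp [h0 x hx.2]
  refine (hXK.norm.mul_const C).mono' (hXK.aestronglyMeasurable.inner hY.aestronglyMeasurable) ?_
  filter_upwards with x
  exact (norm_inner_le_norm _ _).trans (by gcongr; exact hC x)

/-- Nonnegativity of a distributional divergence is a local property. -/
lemma distribDivNonneg_of_local {Ω : Set E} (hΩ : IsOpen Ω) {X : E → E}
    (hX : LocallyIntegrableOn X Ω)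
    (h : ∀ x ∈ Ω, ∃ r, 0 < r ∧ ∀ φ : E → ℝ, ContDiff ℝ ∞ φ → HasCompactSupport φ →
      tsupport φ ⊆ ball x r → (∀ y, 0 ≤ φ y) →
        ∫ y in Ω, inner ℝ (X y) (gradient φ y) ≤ 0) :
    DistribDivNonneg Ω X := by
  refine ⟨hX, fun φ hφ hφs hφΩ hφ0 => ?_⟩
  rw [Right.nonneg_neg_iff]
  choose! r hr hloc using h
  obtain ⟨t, htK, htc⟩ := hφs.isCompact.elim_nhds_subcover (fun x => ball x (r x))
    fun x hx => ball_mem_nhds x (hr x (hφΩ hx))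
  obtain ⟨ρ, hρ⟩ := SmoothPartitionOfUnity.exists_isSubordinate
    (modelWithCornersSelf ℝ E) (isClosed_tsupport φ)
    (fun i : t => ball (i : E) (r i)) (fun _ => isOpen_ball) (htc.trans_eq (biUnion_eq_iUnion _ _))
  have hρs : ∀ i, ContDiff ℝ ∞ (ρ i) := fun i => (ρ i).contMDiff.contDiff
  have hψs : ∀ i, ContDiff ℝ ∞ fun x => ρ i x * φ x := fun i => (hρs i).mul hφ
  have hψc : ∀ i, HasCompactSupport fun x => ρ i x * φ x := fun i => hφs.mul_left
  have hsum : φ = fun x => ∑ i, ρ i x * φ x := by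
    ext x
    rw [← Finset.sum_mul]
    by_cases hx : x ∈ tsupport φ
    · have h1 := ρ.sum_eq_one hx
      rw [finsum_eq_sum_of_fintype] at h1
      rw [h1, one_mul]
    · simp [image_eq_zero_of_notMem_tsupport hx]
  have hgrad : ∀ x, gradient φ x = ∑ i, gradient (fun y => ρ i y * φ y) x := fun x => by
    conv_lhs => rw [hsum]
    simp only [gradient]
    rw [← map_sum, fderiv_fun_sum fun i _ => (hψs i).differentiable (by simp) x]
  simp_rw [hgrad, inner_sum]
  rw [integral_finsetSum]
  · refine Finset.sum_nonpos fun i _ => hloc i (hφΩ (htK i i.2)) _ (hψs i) (hψc i) ?_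
      fun y => mul_nonneg (ρ.nonneg i y) (hφ0 y)
    exact (tsupport_mul_subset_left).trans (hρ i)
  · intro i _
    obtain ⟨C, hC⟩ := (contDiff_gradient (hψs i)).continuous.bounded_above_of_compact_support
      (hasCompactSupport_gradient (hψc i))
    exact integrableOn_inner_of_locallyIntegrableOn hX hΩ.measurableSet (hψc i)
      ((tsupport_mul_subset_right).trans hφΩ) (measurable_gradient _) hC
      fun x hx => gradient_eq_zero_of_notMem_tsupport hx

lemma LocallyConvex.nonnegGeneralizedMeanCurvature {Ω : Set E} (hΩ : IsOpen Ω)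
    (hΩv : volume Ω ≠ ⊤) {f : E → ℝ} (hf : LocallyConvex Ω f) (hcont : ContinuousOn f Ω)
    {L : NNReal} (hL : L < 1)
    (hg : ∀ᵐ x, x ∈ Ω → DifferentiableAt ℝ f x ∧ ‖gradient f x‖ ≤ L) :
    NonnegGeneralizedMeanCurvature Ω f := by
  refine distribDivNonneg_of_local hΩ (IntegrableOn.locallyIntegrableOn ?_) fun x hx => ?_
  · refine Measure.integrableOn_of_bounded (M := (Real.sqrt (1 - (L : ℝ) ^ 2))⁻¹ * L) hΩv
      (measurable_meanCurvatureField f).aestronglyMeasurable ?_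
    filter_upwards [ae_restrict_of_ae hg, ae_restrict_mem hΩ.measurableSet] with x hx hxΩ
    exact norm_meanCurvatureField_le hL (hx hxΩ).2
  · obtain ⟨r, hr, hball, hconv⟩ := hf x hx
    refine ⟨r, hr, fun φ hφ hφs hφb hφ0 => ?_⟩
    obtain ⟨g, hgL, hgc, hfg⟩ := exists_convexOn_lipschitzWith_eqOn hr hconv (hcont.mono hball)
      (hg.mono fun y hy hyb => hy (hball hyb))
    have h0 : ∀ y ∉ ball x r, gradient φ y = 0 := fun y hy =>
      gradient_eq_zero_of_notMem_tsupport fun h => hy (hφb h)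
    rw [setIntegral_eq_integral_of_forall_compl_eq_zero
      fun y hy => by rw [h0 y fun h => hy (hball h), inner_zero_right]]
    refine le_of_eq_of_le (integral_congr_ae (Eventually.of_forall fun y => ?_))
      (integral_inner_meanCurvatureField_nonpos_of_convexOn hL hgL hgc hφ hφs hφ0)
    by_cases hy : y ∈ ball x r
    · simp only [meanCurvatureField, gradient_eq_of_eqOn isOpen_ball hfg hy]
    · simp [h0 y hy]

/-! ### Lipschitz test functions -/

lemma exists_lipschitzWith_of_hasCompactSupport {f : E → ℝ} (hf : LocallyLipschitz f)
    (hs : HasCompactSupport f) : ∃ L, LipschitzWith L f := by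
  obtain ⟨L, hL⟩ := (hf.locallyLipschitzOn (s := cthickening 1 (tsupport f))
    ).exists_lipschitzOnWith_of_compact hs.isCompact.cthickening
  obtain ⟨M, hM⟩ := hf.continuous.bounded_above_of_compact_support hs
  have hM0 : 0 ≤ M := (norm_nonneg _).trans (hM 0)
  have key : ∀ x ∈ tsupport f, ∀ y, dist (f x) (f y) ≤ (L + M.toNNReal : NNReal) * dist x y := by
    intro x hx y
    rw [NNReal.coe_add, Real.coe_toNNReal _ hM0, add_mul]
    by_cases hy : y ∈ cthickening 1 (tsupport f)
    · have := hL.dist_le_mul x (self_subset_cthickening _ hx) y hy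
      have := mul_nonneg hM0 (dist_nonneg (x := x) (y := y))
      linarith
    · have h1 : 1 ≤ dist x y := by
        by_contra! h
        exact hy (mem_cthickening_of_dist_le y x 1 _ hx (by rw [dist_comm]; exact h.le))
      rw [image_eq_zero_of_notMem_tsupport fun h => hy (self_subset_cthickening _ h), dist_zero_right]
      have := mul_nonneg L.2 (dist_nonneg (x := x) (y := y))
      have := hM x
      have := mul_le_mul_of_nonneg_left h1 hM0
      simp only [NNReal.val_eq_coe] at *
      linarith
  refine ⟨L + M.toNNReal, LipschitzWith.of_dist_le_mul fun x y => ?_⟩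
  by_cases hx : x ∈ tsupport f
  · exact key x hx y
  by_cases hy : y ∈ tsupport f
  · rw [dist_comm, dist_comm x]
    exact key y hy x
  · rw [image_eq_zero_of_notMem_tsupport hx, image_eq_zero_of_notMem_tsupport hy, dist_self]
    positivity

/-- A nonnegative distributional divergence may be tested against Lipschitz functions. -/
lemma DistribDivNonneg.integral_inner_gradient_nonpos {Ω : Set E} (hΩ : IsOpen Ω) {X : E → E}
    (hX : DistribDivNonneg Ω X) {ψ : E → ℝ} {L : NNReal} (hψ : LipschitzWith L ψ)
    (hψs : HasCompactSupport ψ) (hψΩ : tsupport ψ ⊆ Ω) (hψ0 : ∀ x, 0 ≤ ψ x) :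
    ∫ x in Ω, inner ℝ (X x) (gradient ψ x) ≤ 0 := by
  obtain ⟨δ, hδ, hδΩ⟩ := hψs.isCompact.exists_cthickening_subset_open hΩ hψΩ
  have hK : IsCompact (cthickening δ (tsupport ψ)) := hψs.isCompact.cthickening
  have hsupp : ∀ᶠ k : ℕ in atTop, tsupport (mollify k ψ) ⊆ cthickening δ (tsupport ψ) := by
    filter_upwards [(tendsto_bump_rOut (n := n)).eventually (gt_mem_nhds hδ)] with k hk
    exact (tsupport_mollify_subset k ψ).trans (cthickening_mono (by simpa [bump] using hk.le) _)
  refine le_of_tendsto (tendsto_integral_filter_of_dominated_convergence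
    (l := atTop) (F := fun k x => inner ℝ (X x) (gradient (mollify k ψ) x))
    ((cthickening δ (tsupport ψ)).indicator fun x => ‖X x‖ * L)
    (Eventually.of_forall fun k => ?_) ?_ ?_ ?_) ?_
  · exact hX.1.aestronglyMeasurable.inner (measurable_gradient _).aestronglyMeasurable
  · filter_upwards [hsupp] with k hk
    filter_upwards with x
    by_cases hx : x ∈ cthickening δ (tsupport ψ)
    · rw [indicator_of_mem hx]
      exact (norm_inner_le_norm _ _).trans (by gcongr; exact norm_gradient_mollify_le k hψ x)
    · rw [gradient_eq_zero_of_notMem_tsupport fun h => hx (hk h)]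
      simp [hx]
  · refine IntegrableOn.integrable_indicator ?_ isClosed_cthickening.measurableSet
    rw [IntegrableOn, Measure.restrict_restrict isClosed_cthickening.measurableSet,
      inter_eq_left.2 hδΩ]
    exact (hX.1.integrableOn_compact_subset hδΩ hK).norm.mul_const _
  · filter_upwards [ae_restrict_of_ae (ae_tendsto_gradient_mollify hψ)] with x hx
    exact tendsto_const_nhds.inner hx
  · filter_upwards [hsupp] with k hk
    have := hX.2 (mollify k ψ) (contDiff_mollify k hψ.continuous)
      (hK.of_isClosed_subset (isClosed_tsupport _) hk) (hk.trans hδΩ) (mollify_nonneg k hψ0)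
    linarith

/-- The excess of `w` over the level `ε` in `Ω`, extended by zero. For `w` vanishing on the
boundary and `ε > 0` it is compactly supported in `Ω`. -/
noncomputable def excess (Ω : Set E) (w : E → ℝ) (ε : ℝ) : E → ℝ :=
  Ω.indicator fun x => max (w x - ε) 0

lemma excess_nonneg (Ω : Set E) (w : E → ℝ) (ε : ℝ) (x : E) : 0 ≤ excess Ω w ε x :=
  indicator_nonneg (fun _ _ => le_max_right _ _) x

lemma tsupport_excess_subset {Ω : Set E} {w : E → ℝ} {ε : ℝ}
    (hw : ContinuousOn w (closure Ω)) :
    tsupport (excess Ω w ε) ⊆ closure Ω ∩ w ⁻¹' Ici ε := by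
  refine closure_minimal (fun x hx => ?_)
    (hw.preimage_isClosed_of_isClosed isClosed_closure isClosed_Ici)
  have hxΩ : x ∈ Ω := by
    by_contra h
    exact hx (indicator_of_notMem h _)
  refine ⟨subset_closure hxΩ, ?_⟩
  by_contra h
  refine hx ?_
  rw [excess, indicator_of_mem hxΩ]
  exact max_eq_right (sub_nonpos.2 (not_le.1 h).le)

lemma tsupport_excess_subset_self {Ω : Set E} {w : E → ℝ} {ε : ℝ} (hΩ : IsOpen Ω)
    (hw : ContinuousOn w (closure Ω))
    (hbd : ∀ x ∈ frontier Ω, w x = 0) (hε : 0 < ε) : tsupport (excess Ω w ε) ⊆ Ω := by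
  intro x hx
  obtain ⟨hxc, hxε⟩ := tsupport_excess_subset hw hx
  by_contra h
  have : ε ≤ w x := hxε
  rw [hbd x (by rw [hΩ.frontier_eq]; exact ⟨hxc, h⟩)] at this
  linarith

lemma hasCompactSupport_excess {Ω : Set E} {w : E → ℝ} {ε : ℝ} (hΩb : Bornology.IsBounded Ω)
    (hw : ContinuousOn w (closure Ω)) :
    HasCompactSupport (excess Ω w ε) :=
  hΩb.isCompact_closure.of_isClosed_subset (isClosed_tsupport _)
    ((tsupport_excess_subset hw).trans inter_subset_left)

lemma exists_lipschitzWith_excess {Ω : Set E} {w : E → ℝ} {ε : ℝ} (hΩ : IsOpen Ω)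
    (hΩb : Bornology.IsBounded Ω)
    (hw : ContinuousOn w (closure Ω)) (hl : LocallyLipschitzOn Ω w)
    (hbd : ∀ x ∈ frontier Ω, w x = 0) (hε : 0 < ε) : ∃ L, LipschitzWith L (excess Ω w ε) := by
  refine exists_lipschitzWith_of_hasCompactSupport (fun x => ?_) (hasCompactSupport_excess hΩb hw)
  by_cases hx : x ∈ Ω
  · obtain ⟨K, t, ht, hK⟩ := hl hx
    rw [hΩ.nhdsWithin_eq hx] at ht
    refine ⟨K, t ∩ Ω, inter_mem ht (hΩ.mem_nhds hx), LipschitzOnWith.of_dist_le_mul ?_⟩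
    intro y hy z hz
    refine le_trans ?_ (hK.dist_le_mul y hy.1 z hz.1)
    rw [excess, indicator_of_mem hy.2, indicator_of_mem hz.2, Real.dist_eq, Real.dist_eq]
    simpa using abs_max_sub_max_le_abs (w y - ε) (w z - ε) 0
  · refine ⟨0, (tsupport (excess Ω w ε))ᶜ, (isClosed_tsupport _).isOpen_compl.mem_nhds
      fun h => hx (tsupport_excess_subset_self hΩ hw hbd hε h), LipschitzOnWith.of_dist_le_mul ?_⟩
    intro y hy z hz
    rw [image_eq_zero_of_notMem_tsupport hy, image_eq_zero_of_notMem_tsupport hz]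
    simp

lemma gradient_eq_zero_of_isMinOn {f : E → ℝ} {U : Set E} (hU : IsOpen U) {x : E} (hx : x ∈ U)
    (h : ∀ y ∈ U, f x ≤ f y) : gradient f x = 0 := by
  have hmin : IsLocalMin f x := mem_of_superset (hU.mem_nhds hx) h
  rw [← norm_eq_zero, norm_gradient, hmin.fderiv_eq_zero, norm_zero]

/-- No differentiability is needed: off the set `{w > ε}` the excess function has a minimum. -/
lemma gradient_excess {Ω : Set E} {w : E → ℝ} {ε : ℝ} (hΩ : IsOpen Ω)
    (hw : ContinuousOn w (closure Ω)) (x : E) :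
    gradient (excess Ω w ε) x = (Ω ∩ w ⁻¹' Ioi ε).indicator (gradient w) x := by
  by_cases hx : x ∈ Ω ∩ w ⁻¹' Ioi ε
  · rw [indicator_of_mem hx]
    have hopen := (hw.mono subset_closure).isOpen_inter_preimage hΩ (isOpen_Ioi (a := ε))
    have h1 : excess Ω w ε =ᶠ[𝓝 x] fun y => w y - ε := by
      filter_upwards [hopen.mem_nhds hx] with y hy
      rw [excess, indicator_of_mem hy.1]
      exact max_eq_left (sub_nonneg.2 (le_of_lt hy.2))
    rw [h1.gradient_eq, gradient, fderiv_sub_const, ← gradient]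
  · rw [indicator_of_notMem hx]
    have h0 : excess Ω w ε x = 0 := by
      by_cases hxΩ : x ∈ Ω
      · rw [excess, indicator_of_mem hxΩ]
        exact max_eq_right (sub_nonpos.2 (not_lt.1 fun h => hx ⟨hxΩ, h⟩))
      · exact indicator_of_notMem hxΩ _
    exact gradient_eq_zero_of_isMinOn isOpen_univ (mem_univ x)
      fun y _ => h0 ▸ excess_nonneg Ω w ε y

/-! ### The stability estimate -/

/-- Rademacher's theorem for locally Lipschitz functions on an open set. -/
lemma ae_differentiableAt_of_locallyLipschitzOn {Ω : Set E} (hΩ : IsOpen Ω) {f : E → ℝ}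
    (hf : LocallyLipschitzOn Ω f) : ∀ᵐ x, x ∈ Ω → DifferentiableAt ℝ f x := by
  rw [ae_iff]
  refine measure_null_of_locally_null _ fun x hx => ?_
  simp only [mem_ofPred_eq, Classical.not_imp] at hx
  obtain ⟨K, t, ht, hK⟩ := hf hx.1
  rw [hΩ.nhdsWithin_eq hx.1] at ht
  obtain ⟨o, hot, ho, hxo⟩ := _root_.mem_nhds_iff.1 ht
  refine ⟨{y | ¬(y ∈ Ω → DifferentiableAt ℝ f y)} ∩ o,
    inter_mem self_mem_nhdsWithin (mem_nhdsWithin_of_mem_nhds (ho.mem_nhds hxo)), ?_⟩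
  refine measure_mono_null (fun y hy => ?_)
    (ae_iff.1 (hK.mono hot).ae_differentiableWithinAt_of_mem)
  simp only [mem_inter_iff, mem_ofPred_eq, Classical.not_imp] at hy ⊢
  exact ⟨hy.2, fun h => hy.1.2 (h.differentiableAt (ho.mem_nhds hy.2))⟩

/-- Strict concavity of `p ↦ √(1 - |p|²)`, quantified. The slope is taken at `c p` but multiplies
`p - q`; for `0 ≤ c ≤ 1` this only helps, since `⟨c p, p - c p⟩ ≥ 0`. -/
lemma half_norm_sub_sq_le {p q : E} (hp : ‖p‖ < 1) (hq : ‖q‖ < 1) {c : ℝ} (hc0 : 0 ≤ c)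
    (hc1 : c ≤ 1) :
    1 / 2 * ‖c • p - q‖ ^ 2 ≤ Real.sqrt (1 - ‖c • p‖ ^ 2) - Real.sqrt (1 - ‖q‖ ^ 2) +
      inner ℝ ((Real.sqrt (1 - ‖c • p‖ ^ 2))⁻¹ • (c • p)) (p - q) := by
  have hP : ‖c • p‖ < 1 := by
    rw [norm_smul, Real.norm_of_nonneg hc0]
    nlinarith [norm_nonneg p]
  have hs2 := Real.sq_sqrt (one_sub_norm_sq_pos hP).le
  have ht2 := Real.sq_sqrt (one_sub_norm_sq_pos hq).le
  have hs := Real.sqrt_pos.2 (one_sub_norm_sq_pos hP)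
  set s := Real.sqrt (1 - ‖c • p‖ ^ 2)
  set t := Real.sqrt (1 - ‖q‖ ^ 2)
  have hs1 : s ≤ 1 := by nlinarith [sq_nonneg ‖c • p‖]
  have hpp : ‖c • p‖ ^ 2 ≤ inner ℝ (c • p) p := by
    rw [norm_smul, Real.norm_of_nonneg hc0, real_inner_smul_left, real_inner_self_eq_norm_sq]
    nlinarith [mul_nonneg (mul_nonneg hc0 (sub_nonneg.2 hc1)) (sq_nonneg ‖p‖)]
  have hsub := norm_sub_sq_real (c • p) q
  have hD := sq_nonneg ‖c • p - q‖
  rw [real_inner_smul_left, inner_sub_right]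
  have hle : s * (1 / 2 * ‖c • p - q‖ ^ 2) ≤
      s * (s - t + s⁻¹ * (inner ℝ (c • p) p - inner ℝ (c • p) q)) := by
    rw [mul_add, ← mul_assoc s s⁻¹, mul_inv_cancel₀ hs.ne', one_mul]
    nlinarith [mul_le_of_le_one_left hD hs1, sq_nonneg (s - t)]
  exact le_of_mul_le_mul_left hle hs

/-- The gain in area density minus half the squared distance of the gradients, with the gradient of
`u₁` scaled by `c`. -/
noncomputable def defect (u₁ u₂ : E → ℝ) (c : ℝ) (x : E) : ℝ :=
  Real.sqrt (1 - ‖c • gradient u₁ x‖ ^ 2) - Real.sqrt (1 - ‖gradient u₂ x‖ ^ 2) -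
    1 / 2 * ‖c • gradient u₁ x - gradient u₂ x‖ ^ 2

@[fun_prop]
lemma measurable_defect (u₁ u₂ : E → ℝ) (c : ℝ) : Measurable (defect u₁ u₂ c) := by
  unfold defect
  fun_prop

lemma sqrt_one_sub_norm_sq_le_one (p : E) : Real.sqrt (1 - ‖p‖ ^ 2) ≤ 1 :=
  Real.sqrt_le_one.2 (by nlinarith [sq_nonneg ‖p‖])

lemma norm_defect_le {u₁ u₂ : E → ℝ} {x : E} (h₁ : ‖gradient u₁ x‖ < 1)
    (h₂ : ‖gradient u₂ x‖ < 1) {c : ℝ} (hc0 : 0 ≤ c) (hc1 : c ≤ 1) :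
    ‖defect u₁ u₂ c x‖ ≤ 3 := by
  have hP : ‖c • gradient u₁ x‖ ≤ 1 := by
    rw [norm_smul, Real.norm_of_nonneg hc0]
    nlinarith [norm_nonneg (gradient u₁ x)]
  have h3 := norm_sub_le (c • gradient u₁ x) (gradient u₂ x)
  have h4 := norm_nonneg (c • gradient u₁ x - gradient u₂ x)
  have h5 := sqrt_one_sub_norm_sq_le_one (c • gradient u₁ x)
  have h6 := sqrt_one_sub_norm_sq_le_one (gradient u₂ x)
  have h7 := Real.sqrt_nonneg (1 - ‖c • gradient u₁ x‖ ^ 2)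
  have h8 := Real.sqrt_nonneg (1 - ‖gradient u₂ x‖ ^ 2)
  have h9 : ‖c • gradient u₁ x - gradient u₂ x‖ ^ 2 ≤ 4 := by nlinarith
  have h10 := sq_nonneg ‖c • gradient u₁ x - gradient u₂ x‖
  rw [defect, Real.norm_eq_abs, abs_le]
  constructor <;> linarith

lemma gradient_const_mul {f : E → ℝ} {x : E} (hf : DifferentiableAt ℝ f x) (c : ℝ) :
    gradient (fun y => c * f y) x = c • gradient f x := by
  rw [gradient, fderiv_const_mul hf, map_smul, ← gradient]

lemma gradient_sub {f g : E → ℝ} {x : E} (hf : DifferentiableAt ℝ f x)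
    (hg : DifferentiableAt ℝ g x) :
    gradient (fun y => f y - g y) x = gradient f x - gradient g x := by
  rw [gradient, fderiv_fun_sub hf hg, map_sub, ← gradient, ← gradient]

/-- The pointwise estimate `half_norm_sub_sq_le` integrated over `{u₁ - u₂ > ε}`, where the
divergence term is tested against the excess of `u₁ - u₂` over `ε`. -/
lemma integral_indicator_defect_nonneg {Ω : Set E} (hΩ : IsOpen Ω) (hΩb : Bornology.IsBounded Ω)
    {u₁ u₂ : E → ℝ} (hLip₁ : LocallyLipschitzOn Ω u₁) (hLip₂ : LocallyLipschitzOn Ω u₂)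
    (hcont : ContinuousOn (fun x => u₁ x - u₂ x) (closure Ω))
    (hs₁ : Spacelike Ω u₁) (hs₂ : Spacelike Ω u₂)
    (hbd : ∀ x ∈ frontier Ω, u₁ x - u₂ x = 0) {c : ℝ} (hc0 : 0 ≤ c) (hc1 : c ≤ 1)
    (hcurv : NonnegGeneralizedMeanCurvature Ω fun x => c * u₁ x) {ε : ℝ} (hε : 0 < ε) :
    0 ≤ ∫ x in Ω, (Ω ∩ (fun x => u₁ x - u₂ x) ⁻¹' Ioi ε).indicator (defect u₁ u₂ c) x := by
  have hlip : LocallyLipschitzOn Ω fun x => u₁ x - u₂ x := hLip₁.sub hLip₂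
  obtain ⟨L, hL⟩ := exists_lipschitzWith_excess hΩ hΩb hcont hlip hbd hε
  have hcs := hasCompactSupport_excess (ε := ε) hΩb hcont
  have hsΩ := tsupport_excess_subset_self hΩ hcont hbd hε
  have hdiv := hcurv.integral_inner_gradient_nonpos hΩ hL hcs hsΩ (excess_nonneg Ω _ ε)
  have hopen : IsOpen (Ω ∩ (fun x => u₁ x - u₂ x) ⁻¹' Ioi ε) :=
    (hcont.mono subset_closure).isOpen_inter_preimage hΩ isOpen_Ioi
  refine (neg_nonneg.2 hdiv).trans ?_
  rw [← integral_neg]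
  refine integral_mono_ae ?_ ?_ ?_
  · exact (integrableOn_inner_of_locallyIntegrableOn hcurv.1 hΩ.measurableSet hcs hsΩ
      (measurable_gradient _) (norm_gradient_le hL)
      fun x hx => gradient_eq_zero_of_notMem_tsupport hx).neg
  · refine Measure.integrableOn_of_bounded (M := 3) hΩb.measure_lt_top.ne
      ((measurable_defect _ _ _).indicator hopen.measurableSet).aestronglyMeasurable ?_
    filter_upwards [hs₁, hs₂] with x h₁ h₂
    exact (norm_indicator_le_norm_self _ _).trans (norm_defect_le h₁ h₂ hc0 hc1)
  · filter_upwards [hs₁, hs₂, ae_restrict_of_ae (ae_differentiableAt_of_locallyLipschitzOn hΩ hLip₁),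
      ae_restrict_of_ae (ae_differentiableAt_of_locallyLipschitzOn hΩ hLip₂),
      ae_restrict_mem hΩ.measurableSet] with x h₁ h₂ hd₁ hd₂ hx
    rw [gradient_excess hΩ hcont]
    by_cases hA : x ∈ Ω ∩ (fun x => u₁ x - u₂ x) ⁻¹' Ioi ε
    · rw [indicator_of_mem hA, indicator_of_mem hA, gradient_sub (hd₁ hx) (hd₂ hx),
        meanCurvatureField, gradient_const_mul (hd₁ hx), defect]
      have := half_norm_sub_sq_le h₁ h₂ hc0 hc1
      linarith
    · rw [indicator_of_notMem hA, indicator_of_notMem hA, inner_zero_right, neg_zero]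

/-- The scalings `c u₁` with `c ↑ 1` are admissible in both cases of the curvature hypothesis. For
locally convex `u₁` the factor `c < 1` is needed, since `Du₁ / √(1 - |Du₁|²)` may fail to be locally
integrable. -/
lemma exists_seq_nonnegGeneralizedMeanCurvature {Ω : Set E} (hΩ : IsOpen Ω)
    (hΩb : Bornology.IsBounded Ω) {u : E → ℝ} (hLip : LocallyLipschitzOn Ω u)
    (hs : Spacelike Ω u)
    (hcurv : LocallyConvex Ω u ∨ NonnegGeneralizedMeanCurvature Ω u) :
    ∃ c : ℕ → ℝ, Tendsto c atTop (𝓝 1) ∧ ∀ k, 0 ≤ c k ∧ c k ≤ 1 ∧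
      NonnegGeneralizedMeanCurvature Ω fun x => c k * u x := by
  rcases hcurv with hconv | hmean
  · refine ⟨fun k => 1 - 1 / ((k : ℝ) + 1), ?_, fun k => ?_⟩
    · simpa using (tendsto_one_div_add_atTop_nhds_zero_nat (𝕜 := ℝ)).const_sub 1
    have hk : 0 < 1 / ((k : ℝ) + 1) := by positivity
    have hk1 : 1 / ((k : ℝ) + 1) ≤ 1 := by
      rw [div_le_one (by positivity)]
      linarith [Nat.cast_nonneg (α := ℝ) k]
    have hc0 : 0 ≤ 1 - 1 / ((k : ℝ) + 1) := by linarith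
    refine ⟨hc0, by linarith, ?_⟩
    set c := 1 - 1 / ((k : ℝ) + 1) with hc
    refine LocallyConvex.nonnegGeneralizedMeanCurvature (L := c.toNNReal) hΩ
      hΩb.measure_lt_top.ne (fun x hx => ?_) (hLip.continuousOn.const_mul c) ?_ ?_
    · obtain ⟨r, hr, hball, hx⟩ := hconv x hx
      exact ⟨r, hr, hball, hx.smul hc0⟩
    · rw [Real.toNNReal_lt_one]
      linarith
    · filter_upwards [ae_differentiableAt_of_locallyLipschitzOn hΩ hLip,
        (ae_restrict_iff' hΩ.measurableSet).1 hs] with x hd hx hxΩ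
      refine ⟨(hd hxΩ).const_mul c, ?_⟩
      rw [gradient_const_mul (hd hxΩ), norm_smul, Real.norm_of_nonneg hc0, Real.coe_toNNReal c hc0]
      exact mul_le_of_le_one_right hc0 (hx hxΩ).le
  · exact ⟨fun _ => 1, tendsto_const_nhds, fun _ => ⟨zero_le_one, le_rfl, by simpa using hmean⟩⟩

lemma integrableOn_sqrt_one_sub_norm_gradient_sq {Ω : Set E} (hΩb : Bornology.IsBounded Ω)
    (u : E → ℝ) : IntegrableOn (fun x => Real.sqrt (1 - ‖gradient u x‖ ^ 2)) Ω := by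
  refine Measure.integrableOn_of_bounded (M := 1) hΩb.measure_lt_top.ne
    (by fun_prop : Measurable _).aestronglyMeasurable (Eventually.of_forall fun x => ?_)
  rw [Real.norm_of_nonneg (Real.sqrt_nonneg _)]
  exact sqrt_one_sub_norm_sq_le_one _

lemma integrableOn_norm_gradient_sub_sq {Ω : Set E} (hΩb : Bornology.IsBounded Ω)
    {u₁ u₂ : E → ℝ} (hs₁ : Spacelike Ω u₁) (hs₂ : Spacelike Ω u₂) :
    IntegrableOn (fun x => ‖gradient u₁ x - gradient u₂ x‖ ^ 2) Ω := by
  refine Measure.integrableOn_of_bounded (M := 4) hΩb.measure_lt_top.ne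
    (by fun_prop : Measurable _).aestronglyMeasurable ?_
  filter_upwards [hs₁, hs₂] with x h₁ h₂
  have h3 := norm_sub_le (gradient u₁ x) (gradient u₂ x)
  have h4 := norm_nonneg (gradient u₁ x - gradient u₂ x)
  rw [Real.norm_of_nonneg (sq_nonneg _)]
  nlinarith

/-- The area deficit controls the `L²` distance of the gradients. -/
lemma half_integral_norm_gradient_sub_sq_le {Ω : Set E} (hΩ : IsOpen Ω)
    (hΩb : Bornology.IsBounded Ω) {u₁ u₂ : E → ℝ} (hLip₁ : LocallyLipschitzOn Ω u₁)
    (hLip₂ : LocallyLipschitzOn Ω u₂)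
    (hcont : ContinuousOn (fun x => u₁ x - u₂ x) (closure Ω))
    (hs₁ : Spacelike Ω u₁) (hs₂ : Spacelike Ω u₂) (hle : ∀ x ∈ Ω, u₂ x ≤ u₁ x)
    (hbd : ∀ x ∈ frontier Ω, u₁ x - u₂ x = 0)
    (hcurv : LocallyConvex Ω u₁ ∨ NonnegGeneralizedMeanCurvature Ω u₁) :
    1 / 2 * ∫ x in Ω, ‖gradient u₁ x - gradient u₂ x‖ ^ 2 ≤ area Ω u₁ - area Ω u₂ := by
  obtain ⟨c, hc, hck⟩ := exists_seq_nonnegGeneralizedMeanCurvature hΩ hΩb hLip₁ hs₁ hcurv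
  have hopen : ∀ ε, IsOpen (Ω ∩ (fun x => u₁ x - u₂ x) ⁻¹' Ioi ε) := fun ε =>
    (hcont.mono subset_closure).isOpen_inter_preimage hΩ isOpen_Ioi
  have hmeas : ∀ ε a, AEStronglyMeasurable
      (fun x => (Ω ∩ (fun x => u₁ x - u₂ x) ⁻¹' Ioi ε).indicator (defect u₁ u₂ a) x)
      (volume.restrict Ω) := fun ε a =>
    ((measurable_defect _ _ _).indicator (hopen ε).measurableSet).aestronglyMeasurable
  have hbound : ∀ ε a, 0 ≤ a → a ≤ 1 → ∀ᵐ x ∂volume.restrict Ω,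
      ‖(Ω ∩ (fun x => u₁ x - u₂ x) ⁻¹' Ioi ε).indicator (defect u₁ u₂ a) x‖ ≤ 3 :=
    fun ε a ha0 ha1 => by
      filter_upwards [hs₁, hs₂] with x h₁ h₂
      exact (norm_indicator_le_norm_self _ _).trans (norm_defect_le h₁ h₂ ha0 ha1)
  have hint : IntegrableOn (fun _ : E => (3 : ℝ)) Ω := integrableOn_const hΩb.measure_lt_top.ne
  have hε : ∀ ε : ℝ, 0 < ε →
      0 ≤ ∫ x in Ω, (Ω ∩ (fun x => u₁ x - u₂ x) ⁻¹' Ioi ε).indicator (defect u₁ u₂ 1) x :=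
    fun ε hε => by
      refine ge_of_tendsto' (tendsto_integral_of_dominated_convergence (F := fun k x =>
        (Ω ∩ (fun x => u₁ x - u₂ x) ⁻¹' Ioi ε).indicator (defect u₁ u₂ (c k)) x) (fun _ => 3)
        (fun k => hmeas ε _) hint (fun k => hbound ε _ (hck k).1 (hck k).2.1)
        (Eventually.of_forall fun x => ?_)) fun k =>
        integral_indicator_defect_nonneg hΩ hΩb hLip₁ hLip₂ hcont hs₁ hs₂ hbd (hck k).1
          (hck k).2.1 (hck k).2.2 hε
      by_cases hx : x ∈ Ω ∩ (fun x => u₁ x - u₂ x) ⁻¹' Ioi ε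
      · simp only [indicator_of_mem hx]
        have hcont' : Continuous fun a : ℝ => defect u₁ u₂ a x := by
          unfold defect
          fun_prop
        exact (hcont'.tendsto 1).comp hc
      · simp only [indicator_of_notMem hx]
        exact tendsto_const_nhds
  have h0 : 0 ≤ ∫ x in Ω, defect u₁ u₂ 1 x := by
    refine ge_of_tendsto' (tendsto_integral_of_dominated_convergence (F := fun (k : ℕ) x =>
      (Ω ∩ (fun x => u₁ x - u₂ x) ⁻¹' Ioi (1 / ((k : ℝ) + 1))).indicator (defect u₁ u₂ 1) x)
      (fun _ => 3) (fun k => hmeas _ _) hint (fun k => hbound _ _ zero_le_one le_rfl) ?_)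
      fun k => hε _ (by positivity)
    filter_upwards [ae_restrict_of_ae (ae_differentiableAt_of_locallyLipschitzOn hΩ hLip₁),
      ae_restrict_of_ae (ae_differentiableAt_of_locallyLipschitzOn hΩ hLip₂),
      ae_restrict_mem hΩ.measurableSet] with x hd₁ hd₂ hx
    rcases (hle x hx).eq_or_lt with heq | hlt
    · -- On the contact set `u₁ - u₂` has a minimum, so the gradients agree there.
      have hg : gradient u₁ x - gradient u₂ x = 0 := by
        rw [← gradient_sub (hd₁ hx) (hd₂ hx)]
        exact gradient_eq_zero_of_isMinOn hΩ hx fun y hy => by linarith [hle y hy]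
      have hd : defect u₁ u₂ 1 x = 0 := by
        simp [defect, sub_eq_zero.1 hg]
      rw [hd]
      refine tendsto_const_nhds.congr fun k => ?_
      by_cases hm : x ∈ Ω ∩ (fun x => u₁ x - u₂ x) ⁻¹' Ioi (1 / ((k : ℝ) + 1))
      · rw [indicator_of_mem hm, hd]
      · rw [indicator_of_notMem hm]
    · refine tendsto_const_nhds.congr' ?_
      filter_upwards [(tendsto_one_div_add_atTop_nhds_zero_nat (𝕜 := ℝ)).eventually
        (gt_mem_nhds (sub_pos.2 hlt))] with k hk
      exact (indicator_of_mem (show x ∈ Ω ∩ _ from ⟨hx, hk⟩) _).symm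
  have hsplit : ∫ x in Ω, defect u₁ u₂ 1 x = area Ω u₁ - area Ω u₂ -
      1 / 2 * ∫ x in Ω, ‖gradient u₁ x - gradient u₂ x‖ ^ 2 := by
    have hi₁ := integrableOn_sqrt_one_sub_norm_gradient_sq hΩb u₁
    have hi₂ := integrableOn_sqrt_one_sub_norm_gradient_sq hΩb u₂
    have hi₃ := (integrableOn_norm_gradient_sub_sq hΩb hs₁ hs₂).const_mul (1 / 2)
    have h := integral_sub (hi₁.sub hi₂) hi₃
    simp only [Pi.sub_apply] at h
    rw [area, area, ← integral_sub hi₁ hi₂, ← integral_const_mul, ← h]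
    simp [defect]
  linarith

end MinkowskiGraph

open MinkowskiGraph in
theorem mainTheorem9 (n : ℕ) (hn : 1 ≤ n) (Ω : Set (EuclideanSpace ℝ (Fin n)))
    (hΩ : IsOpen Ω) (hΩb : Bornology.IsBounded Ω)
    (u₁ u₂ : EuclideanSpace ℝ (Fin n) → ℝ)
    (hLip₁ : LocallyLipschitzOn Ω u₁) (hLip₂ : LocallyLipschitzOn Ω u₂)
    (hcont₁ : ContinuousOn u₁ (closure Ω)) (hcont₂ : ContinuousOn u₂ (closure Ω))
    (hs₁ : MinkowskiGraph.Spacelike Ω u₁) (hs₂ : MinkowskiGraph.Spacelike Ω u₂)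
    (hle : ∀ x ∈ closure Ω, u₂ x ≤ u₁ x)
    (hbd : ∀ x ∈ frontier Ω, u₁ x = u₂ x)
    (hcurv : MinkowskiGraph.LocallyConvex Ω u₁ ∨
      MinkowskiGraph.NonnegGeneralizedMeanCurvature Ω u₁) :
    MinkowskiGraph.area Ω u₂ ≤ MinkowskiGraph.area Ω u₁ ∧
      (MinkowskiGraph.area Ω u₁ = MinkowskiGraph.area Ω u₂ ↔ ∀ x ∈ Ω, u₁ x = u₂ x) := by
  have hcont : ContinuousOn (fun x => u₁ x - u₂ x) (closure Ω) := hcont₁.sub hcont₂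
  have hbd' : ∀ x ∈ frontier Ω, u₁ x - u₂ x = 0 := fun x hx => sub_eq_zero.2 (hbd x hx)
  have key := half_integral_norm_gradient_sub_sq_le hΩ hΩb hLip₁ hLip₂ hcont hs₁ hs₂
    (fun x hx => hle x (subset_closure hx)) hbd' hcurv
  have hnn : 0 ≤ ∫ x in Ω, ‖gradient u₁ x - gradient u₂ x‖ ^ 2 :=
    integral_nonneg fun x => sq_nonneg _
  refine ⟨by linarith, fun heq x hx => ?_, fun heq => ?_⟩
  · have h0 : ∫ x in Ω, ‖gradient u₁ x - gradient u₂ x‖ ^ 2 = 0 := by linarith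
    rw [setIntegral_eq_zero_iff_of_nonneg_ae (Filter.Eventually.of_forall fun x => sq_nonneg _)
      (integrableOn_norm_gradient_sub_sq hΩb hs₁ hs₂)] at h0
    have h0' := (ae_restrict_iff' hΩ.measurableSet).1 h0
    refine le_antisymm (le_of_forall_pos_le_add fun ε hε => ?_) (hle x (subset_closure hx))
    obtain ⟨L, hL⟩ := exists_lipschitzWith_excess hΩ hΩb hcont (hLip₁.sub hLip₂) hbd' hε
    have hz := eq_zero_of_gradient_ae_eq_zero hn hL (hasCompactSupport_excess hΩb hcont) ?_ x
    · rw [excess, Set.indicator_of_mem hx] at hz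
      linarith [le_max_left (u₁ x - u₂ x - ε) 0]
    · filter_upwards [h0', ae_differentiableAt_of_locallyLipschitzOn hΩ hLip₁,
        ae_differentiableAt_of_locallyLipschitzOn hΩ hLip₂] with y hy hd₁ hd₂
      rw [gradient_excess hΩ hcont]
      refine Set.indicator_apply_eq_zero.2 fun hyA => ?_
      rw [gradient_sub (hd₁ hyA.1) (hd₂ hyA.1)]
      simpa using hy hyA.1
  · refine setIntegral_congr_fun hΩ.measurableSet fun x hx => ?_
    simp only [gradient_eq_of_eqOn hΩ heq hx]
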